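/- Let $E$ be a Fréchet space over $\mathbb R$ or $\mathbb C$ whose topology is generated by an increasing sequence of seminorms $(\|\cdot\|_k)_k$, with dual seminorms $\|\varphi\|_k^*=\sup\{|\varphi(x)|:\|x\|_k\le 1\}\in[0,\infty]$ for $\varphi$ in the dual $E^*$. The space $E$ has property $\widetilde\Omega$ if $$\forall p\ \exists q,\ d>0\ \forall k\ \exists C>0\ \forall\varphi\in E^*:\quad \|\varphi\|_q^*\le C\,(\|\varphi\|_p^*)^{\frac{d}{1+d}}(\|\varphi\|_k^*)^{\frac1{1+d}}$$ (this does not depend on the choice of the generating sequence). The diametral dimension $\Delta(E)$ is the set of all scalar sequences $(\xi_n)_{n\ge0}$ such that for every neighbourhood $U$ of $0$ there is a neighbourhood $V$ of $0$ with $\xi_n d_n(V,U)\to0$, where $d_n(V,U)=\inf\{r>0: V\subseteq rU+F \text{ for some linear subspace } F\subseteq E,\ \dim F\le n\}$. For a sequence $0\le\alpha_0\le\alpha_1\le\dots$ with $\alpha_n\to\infty$, let $\Lambda_\infty(\alpha)$ be the power series space of infinite type, i.e. the space of scalar sequences $x$ with $\|x\|_t=\bigl(\sum_n|x_n|^2e^{2t\alpha_n}\bigr)^{1/2}<\infty$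 for all $t\in\mathbb R$, with the topology generated by these seminorms; $\alpha$ is weakly stable if $\limsup_n \alpha_{n+1}/\alpha_n<\infty$. (1) Let $X$ be a nuclear Fréchet space. If there is a weakly stable sequence $\alpha$ as above such that $\Lambda_\infty(\alpha)$ (over the same scalar field) is nuclear and $\Delta(X)=\Delta(\Lambda_\infty(\alpha))$, then $X$ does not have property $\widetilde\Omega$. (2) Let $M$ be a connected Stein manifold of complex dimension $n\ge1$ that is parabolic, i.e. every plurisubharmonic function $u:M\to[-\infty,\infty)$ that is bounded above is constant. Then the Fréchet space $O(M)$ of holomorphic functions on $M$, with the compact-open topology, does not have property $\widetilde\Omega$. -/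

import Mathlib

open Set Filter Topology MeasureTheory
open scoped ENNReal Manifold ContDiff Pointwise

noncomputable section

/-! ### Property `Ω̃`, nuclearity and diametral dimension -/

section LinearTopology

variable (𝕜 : Type*) [RCLike 𝕜]
variable {E : Type*} [AddCommGroup E] [Module 𝕜 E] [TopologicalSpace E]

/-- The seminorm dual to `p`: `‖φ‖*_p = sup {|φ x| : p x ≤ 1}`, with values in `[0, ∞]`. -/
def dualSeminorm {𝕜 : Type*} [RCLike 𝕜] {E : Type*} [AddCommGroup E] [Module 𝕜 E]
    [TopologicalSpace E] (p : Seminorm 𝕜 E) (φ : E →L[𝕜] 𝕜) : ℝ≥0∞ :=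
  ⨆ x ∈ {x : E | p x ≤ 1}, ‖φ x‖ₑ

/-- The estimate `Ω̃` with respect to the sequence of seminorms `p`. -/
def OmegaTildeFor {𝕜 : Type*} [RCLike 𝕜] {E : Type*} [AddCommGroup E] [Module 𝕜 E]
    [TopologicalSpace E] (p : ℕ → Seminorm 𝕜 E) : Prop :=
  ∀ m : ℕ, ∃ q : ℕ, ∃ d : ℝ, 0 < d ∧ ∀ k : ℕ, ∃ C : ℝ, 0 < C ∧ ∀ φ : E →L[𝕜] 𝕜,
    dualSeminorm (p q) φ ≤
      ENNReal.ofReal C * dualSeminorm (p m) φ ^ (d / (1 + d)) *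
        dualSeminorm (p k) φ ^ (1 / (1 + d))

variable (E) in
/-- `E` has the property `Ω̃`: the estimate holds for some increasing sequence of seminorms that
generates the topology of `E`. (It then holds for every such sequence.) -/
def HasOmegaTilde : Prop :=
  ∃ p : ℕ → Seminorm 𝕜 E, Monotone p ∧ WithSeminorms p ∧ OmegaTildeFor p

variable (E) in
/-- `E` is nuclear: for each continuous seminorm `p` there is a continuous seminorm `q ≥ p` such
that the canonical map from the local Banach space of `q` to that of `p` is nuclear, i.e. has a
representation `x = ∑ φ n (x) y n` with `∑ ‖φ n‖*_q p (y n) < ∞`. By density (splitting each vector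
of the local Banach space of `p` into an absolutely convergent series of vectors of `E`) the `y n`
can be taken in `E` itself. -/
def IsNuclearSpace : Prop :=
  ∀ p : Seminorm 𝕜 E, Continuous p → ∃ q : Seminorm 𝕜 E, Continuous q ∧ p ≤ q ∧
    ∃ (φ : ℕ → E →L[𝕜] 𝕜) (y : ℕ → E),
      (∀ n, dualSeminorm q (φ n) ≠ ⊤) ∧
      (∑' n, dualSeminorm q (φ n) * ENNReal.ofReal (p (y n)) ≠ ⊤) ∧
      ∀ x : E, Tendsto (fun N : ℕ => p (x - ∑ n ∈ Finset.range N, φ n x • y n)) atTop (𝓝 0)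

/-- The `n`-th Kolmogorov diameter of `V` with respect to `U`: the infimum of the `r > 0` such that
`V ⊆ r U + F` for a linear subspace `F` of dimension at most `n` (`∞` if there is no such `r`). -/
def kolmogorovDiameter (V U : Set E) (n : ℕ) : ℝ≥0∞ :=
  ⨅ (r : ℝ) (_ : 0 < r)
    (_ : ∃ F : Submodule 𝕜 E, Module.rank 𝕜 F ≤ n ∧ V ⊆ (r : 𝕜) • U + (F : Set E)),
    ENNReal.ofReal r

variable (E) in
/-- The diametral dimension `Δ(E)`: all scalar sequences `ξ` such that for each neighbourhood `U`
of zero there is a neighbourhood `V` of zero with `ξ n * d n (V, U) → 0`. -/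
def diametralDimension : Set (ℕ → 𝕜) :=
  {ξ | ∀ U ∈ 𝓝 (0 : E), ∃ V ∈ 𝓝 (0 : E),
    Tendsto (fun n => ‖ξ n‖ₑ * kolmogorovDiameter 𝕜 V U n) atTop (𝓝 0)}

end LinearTopology

/-! ### Power series spaces of infinite type -/

section PowerSeries

/-- Exponent sequences: nonnegative, increasing and tending to infinity. -/
structure IsExponentSequence (α : ℕ → ℝ) : Prop where
  nonneg : ∀ n, 0 ≤ α n
  mono : Monotone α
  tendsto : Tendsto α atTop atTop

/-- Weak stability: `limsup α (n + 1) / α n < ∞`. -/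
def IsWeaklyStable (α : ℕ → ℝ) : Prop :=
  ∃ C : ℝ, ∀ᶠ n in atTop, α (n + 1) ≤ C * α n

variable (𝕜 : Type*) [RCLike 𝕜] (α : ℕ → ℝ)

/-- Sequences `x` with `∑ |x n|² e^{2 t α n} < ∞` for all real `t`. -/
def powerSeriesSubmodule : Submodule 𝕜 (ℕ → 𝕜) where
  carrier := {x | ∀ t : ℝ, Memℓp (fun n => (Real.exp (t * α n) : 𝕜) * x n) 2}
  zero_mem' t := by
    have h : (fun n => (Real.exp (t * α n) : 𝕜) * (0 : ℕ → 𝕜) n) = fun _ => 0 := by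
      funext n; simp
    rw [h]
    exact zero_memℓp
  add_mem' {x y} hx hy t := by
    have h : (fun n => (Real.exp (t * α n) : 𝕜) * (x + y) n) =
        (fun n => (Real.exp (t * α n) : 𝕜) * x n) + fun n => (Real.exp (t * α n) : 𝕜) * y n := by
      funext n; simp [mul_add]
    rw [h]
    exact (hx t).add (hy t)
  smul_mem' c x hx t := by
    have h : (fun n => (Real.exp (t * α n) : 𝕜) * (c • x) n) =
        c • fun n => (Real.exp (t * α n) : 𝕜) * x n := by
      funext n; simp [mul_left_comm]
    rw [h]
    exact (hx t).const_smul c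

/-- The power series space of infinite type `Λ_∞(α)`. It is a type of its own, since its topology
is not the one induced by the product topology. -/
def PowerSeriesSpace : Type _ := powerSeriesSubmodule 𝕜 α

instance : AddCommGroup (PowerSeriesSpace 𝕜 α) :=
  inferInstanceAs (AddCommGroup (powerSeriesSubmodule 𝕜 α))

instance : Module 𝕜 (PowerSeriesSpace 𝕜 α) :=
  inferInstanceAs (Module 𝕜 (powerSeriesSubmodule 𝕜 α))

/-- The weighting map `x ↦ (e^{t α n} x n)` from `Λ_∞(α)` to `ℓ²`. -/
def PowerSeriesSpace.toL2 (t : ℝ) : PowerSeriesSpace 𝕜 α →ₗ[𝕜] lp (fun _ : ℕ => 𝕜) 2 where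
  toFun x := ⟨fun n => (Real.exp (t * α n) : 𝕜) * x.1 n, x.2 t⟩
  map_add' x y := by
    ext n
    exact mul_add (Real.exp (t * α n) : 𝕜) (x.1 n) (y.1 n)
  map_smul' c x := by
    ext n
    exact mul_left_comm (Real.exp (t * α n) : 𝕜) c (x.1 n)

/-- The seminorms `‖x‖_t = (∑ |x n|² e^{2 t α n})^{1/2}`, for real `t`. -/
def PowerSeriesSpace.seminorm : SeminormFamily 𝕜 (PowerSeriesSpace 𝕜 α) ℝ := fun t =>
  (normSeminorm 𝕜 (lp (fun _ : ℕ => 𝕜) 2)).comp (PowerSeriesSpace.toL2 𝕜 α t)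

/-- The topology of `Λ_∞(α)`, generated by the seminorms `‖·‖_t`. -/
instance : TopologicalSpace (PowerSeriesSpace 𝕜 α) :=
  (PowerSeriesSpace.seminorm 𝕜 α).moduleFilterBasis.topology

theorem PowerSeriesSpace.withSeminorms : WithSeminorms (PowerSeriesSpace.seminorm 𝕜 α) := ⟨rfl⟩

end PowerSeries

/-! ### Plurisubharmonic functions and parabolic Stein manifolds -/

section Manifolds

/-- The mean value of `u` over the circle `{a + e^{iθ} b}`, as a difference of the (normalized)
integrals of its positive and negative parts. For `u < ∞` upper semicontinuous on the circle the
first of them is finite. -/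
def circleMean {V : Type*} [AddCommGroup V] [Module ℂ V] (u : V → EReal) (a b : V) : EReal :=
  (((∫⁻ θ in Ioc 0 (2 * Real.pi), (u (a + Complex.exp (θ * Complex.I) • b)).toENNReal) /
      ENNReal.ofReal (2 * Real.pi) : ℝ≥0∞) : EReal) -
  (((∫⁻ θ in Ioc 0 (2 * Real.pi), (-u (a + Complex.exp (θ * Complex.I) • b)).toENNReal) /
      ENNReal.ofReal (2 * Real.pi) : ℝ≥0∞) : EReal)

/-- `u` is plurisubharmonic on the open set `W`: it is upper semicontinuous with values in
`[-∞, ∞)` and has the sub-mean value property on each closed affine disc contained in `W`.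
(The function that is identically `-∞` is admitted.) -/
def IsPlurisubharmonicOn {V : Type*} [NormedAddCommGroup V] [NormedSpace ℂ V] (u : V → EReal)
    (W : Set V) : Prop :=
  UpperSemicontinuousOn u W ∧ (∀ z ∈ W, u z < ⊤) ∧
    ∀ a b : V, (∀ c : ℂ, ‖c‖ ≤ 1 → a + c • b ∈ W) → u a ≤ circleMean u a b

variable (n : ℕ) (M : Type*) [TopologicalSpace M] [ChartedSpace (EuclideanSpace ℂ (Fin n)) M]

/-- A function on a complex manifold is plurisubharmonic if it is so in local coordinates. -/
def IsPlurisubharmonic {M : Type*} [TopologicalSpace M]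
    [ChartedSpace (EuclideanSpace ℂ (Fin n)) M] (u : M → EReal) : Prop :=
  ∀ e ∈ atlas (EuclideanSpace ℂ (Fin n)) M, IsPlurisubharmonicOn (u ∘ e.symm) e.target

/-- `O(M)`, the space of holomorphic functions on `M`. Its topology is the one induced by the
compact-open topology of `C(M, ℂ)`. -/
def HolomorphicFunctions : Submodule ℂ C(M, ℂ) where
  carrier := {f | MDifferentiable 𝓘(ℂ, EuclideanSpace ℂ (Fin n)) 𝓘(ℂ, ℂ) f}
  zero_mem' := mdifferentiable_const (c := (0 : ℂ))
  add_mem' hf hg := MDifferentiable.add hf hg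
  smul_mem' c _ hf := MDifferentiable.const_smul c hf

/-- The complex manifold `M` is Stein: it is holomorphically convex and holomorphically
separable. -/
structure IsStein : Prop where
  convex : ∀ K : Set M, IsCompact K →
    IsCompact {z : M | ∀ f ∈ HolomorphicFunctions n M, ∃ w ∈ K, ‖f z‖ ≤ ‖f w‖}
  separates : ∀ z w : M, z ≠ w → ∃ f ∈ HolomorphicFunctions n M, f z ≠ f w

/-- `M` is parabolic: every plurisubharmonic function on `M` that is bounded above is constant. -/
def IsParabolic : Prop :=
  ∀ u : M → EReal, IsPlurisubharmonic n u → (∃ C : ℝ, ∀ z, u z ≤ C) → ∃ c : EReal, ∀ z, u z = c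

end Manifolds

end

/-!
Both parts rest on the primal form of `Ω̃`. By Hahn–Banach, the estimate for the dual seminorms
says that each vector of the unit ball `U_q` splits, for every `r > 0`, into a part in `D r ^ d U_k`
and a part in `r⁻¹ U_m` (`exists_decomposition_of_dualSeminorm_le`), where `q` and `d` depend on `m`
only, and `D` also on `k`.

For a space `X` with `Δ(X) = Δ(Λ_∞(α))`, every sequence `e^{s α n}` lies in `Δ(X)`. The
decomposition turns a bound of order `e^{-s (1 + d) α n}` for the diameters of `U_k` with respect to
`U_m`, where `k` may depend on `s`, into a bound of order `e^{-s α n}` for those of the fixed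
neighbourhood `U_q` (`OmegaTildeFor.exists_forall_kolmogorovDiameter_le`). A diagonal sequence
`e^{t n α n}` with `t n → ∞` then belongs to `Δ(X)`, but not to `Δ(Λ_∞(α))`, by the lower bound
`PowerSeriesSpace.le_kolmogorovDiameter` for the diameters of the Hilbert balls of `Λ_∞(α)`.

On a Stein manifold, take a holomorphic `f` with a zero `w` and a point `z` where `f z = 1`.
Decomposing the powers `(ρ f) ^ j` with `r` exponential in `j` gives holomorphic functions `g_j`
that are exponentially close to `(ρ f) ^ j` near `w` and at `z`, and of size at most `A ^ j` on any
compact set, with the same `A` for all compact sets (`HolomorphicFunctions.exists_approximants`).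
Hence the upper relaxed limit of `log |g_j| / j` is bounded above on the whole manifold. It is
plurisubharmonic, by Jensen's inequality and Fatou's lemma
(`isPlurisubharmonic_neg_relaxedLiminf`), and takes different values at `w` and `z`, so the manifold
is not parabolic.
-/

noncomputable section

section LinearTopologyLemmas

variable {𝕜 : Type*} [RCLike 𝕜] {E : Type*} [AddCommGroup E] [Module 𝕜 E]

/-! ### Consequences of `Ω̃` for the seminorms -/

section Topology

variable [TopologicalSpace E]

theorem dualSeminorm_le_ofReal {p : Seminorm 𝕜 E} {φ : E →L[𝕜] 𝕜} {c : ℝ} (hc : 0 ≤ c)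
    (h : ∀ x, ‖φ x‖ ≤ c * p x) : dualSeminorm p φ ≤ ENNReal.ofReal c := by
  refine iSup₂_le fun x hx => ?_
  rw [← ofReal_norm]
  exact ENNReal.ofReal_le_ofReal ((h x).trans (mul_le_of_le_one_right hc hx))

theorem enorm_le_dualSeminorm {p : Seminorm 𝕜 E} (φ : E →L[𝕜] 𝕜) {x : E} (hx : p x ≤ 1) :
    ‖φ x‖ₑ ≤ dualSeminorm p φ :=
  le_iSup₂_of_le (f := fun (x : E) (_ : x ∈ {x | p x ≤ 1}) => ‖φ x‖ₑ) x hx le_rfl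

/-- The interpolation estimate for the dual seminorms of `p₀, p₁, p₂` in its primal form: the unit
ball of `p₁` lies in `D r ^ d U₂ + r⁻¹ U₀` for all `r > 0`. If `x` were not in this set, the
infimal convolution of the suitably rescaled `p₂` and `p₀` would be at least `1` at `x`, and a
functional dominated by it that attains its value at `x` would violate the estimate. -/
theorem exists_decomposition_of_dualSeminorm_le [PolynormableSpace 𝕜 E] {p₀ p₁ p₂ : Seminorm 𝕜 E}
    (hp₀ : Continuous p₀) {d C : ℝ} (hd : 0 < d) (hC : 0 < C)
    (h : ∀ φ : E →L[𝕜] 𝕜, dualSeminorm p₁ φ ≤ ENNReal.ofReal C *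
      dualSeminorm p₀ φ ^ (d / (1 + d)) * dualSeminorm p₂ φ ^ (1 / (1 + d))) :
    ∃ D : ℝ, 0 < D ∧ ∀ r : ℝ, 0 < r → ∀ x, p₁ x ≤ 1 →
      ∃ y, p₂ y ≤ D * r ^ d ∧ p₀ (x - y) ≤ r⁻¹ := by
  refine ⟨(2 * C) ^ (1 + d), by positivity, fun r hr x hx => ?_⟩
  set a : ℝ := (2 * C) ^ (1 + d) * r ^ d with ha
  have ha0 : 0 < a := by positivity
  set P : Seminorm 𝕜 E := (a⁻¹.toNNReal • p₂) ⊓ (r.toNNReal • p₀) with hP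
  have hP₂ : ∀ y, P y ≤ a⁻¹ * p₂ y := fun y => by
    have h1 : P ≤ a⁻¹.toNNReal • p₂ := inf_le_left
    simpa [NNReal.smul_def, ha0.le] using h1 y
  have hP₀ : ∀ y, P y ≤ r * p₀ y := fun y => by
    have h1 : P ≤ r.toNNReal • p₀ := inf_le_right
    simpa [NNReal.smul_def, hr.le] using h1 y
  rcases lt_or_ge (P x) 1 with hlt | hge
  · rw [hP, Seminorm.inf_apply] at hlt
    obtain ⟨y, hy⟩ := exists_lt_of_ciInf_lt hlt
    simp only [smul_apply, NNReal.smul_def, smul_eq_mul, Real.coe_toNNReal _ hr.le,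
      Real.coe_toNNReal _ (inv_pos.2 ha0).le] at hy
    have h2 : 0 ≤ a⁻¹ * p₂ y := by positivity
    have h0 : 0 ≤ r * p₀ (x - y) := by positivity
    refine ⟨y, ?_, ?_⟩
    · have : a⁻¹ * p₂ y ≤ 1 := by linarith
      rwa [inv_mul_le_iff₀ ha0, mul_one] at this
    · rw [← one_div, le_div_iff₀' hr]
      linarith
  · exfalso
    have hx0 : x ≠ 0 := by
      rintro rfl
      rw [map_zero] at hge
      linarith
    have hPc : Continuous P := by
      have h1 : Continuous (r.toNNReal • p₀ : Seminorm 𝕜 E) := by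
        simpa [FunLike.coe_smul] using! hp₀.const_smul r.toNNReal
      have := (PolynormableSpace.withSeminorms 𝕜 E).topologicalAddGroup
      have := (PolynormableSpace.withSeminorms 𝕜 E).continuousSMul
      exact Seminorm.continuous_of_le h1 inf_le_right
    let e := LinearEquiv.toSpanNonzeroSingleton 𝕜 E x hx0
    obtain ⟨φ, hφ, hφP⟩ := Module.Dual.exists_continuous_extension_of_le_seminorm
      (Submodule.span 𝕜 {x}) ((P x : 𝕜) • (e.symm : _ →ₗ[𝕜] 𝕜)) hPc (by
        intro y
        obtain ⟨c, rfl⟩ := e.surjective y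
        have : ((e c : _) : E) = c • x := rfl
        simp [this, map_smul_eq_mul, norm_smul, abs_of_nonneg (apply_nonneg P x), mul_comm])
    have hφx : φ x = (P x : 𝕜) := by
      have := hφ (e 1)
      have h1 : ((e 1 : _) : E) = x := one_smul 𝕜 x
      simpa [h1, RCLike.real_smul_eq_coe_mul] using this
    have h1 : (1 : ℝ≥0∞) ≤ dualSeminorm p₁ φ := by
      refine le_trans ?_ (enorm_le_dualSeminorm φ hx)
      rw [hφx, ← ofReal_norm, ← ENNReal.ofReal_one]
      apply ENNReal.ofReal_le_ofReal
      simpa [abs_of_nonneg (apply_nonneg P x)] using hge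
    have h2 := dualSeminorm_le_ofReal (inv_pos.2 ha0).le (fun y => (hφP y).trans (hP₂ y))
    have h0 := dualSeminorm_le_ofReal hr.le (fun y => (hφP y).trans (hP₀ y))
    have h3 : (1 : ℝ≥0∞) ≤ ENNReal.ofReal (C * r ^ (d / (1 + d)) * a⁻¹ ^ (1 / (1 + d))) := by
      rw [ENNReal.ofReal_mul (by positivity), ENNReal.ofReal_mul hC.le,
        ← ENNReal.ofReal_rpow_of_nonneg hr.le (by positivity),
        ← ENNReal.ofReal_rpow_of_nonneg (inv_pos.2 ha0).le (by positivity)]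
      refine h1.trans ((h φ).trans ?_)
      gcongr
    have h4 : C * r ^ (d / (1 + d)) * a⁻¹ ^ (1 / (1 + d)) = 1 / 2 := by
      have hd1 : (1 + d) ≠ 0 := by positivity
      rw [ha, Real.inv_rpow (by positivity), Real.mul_rpow (by positivity) (by positivity),
        ← Real.rpow_mul (by positivity), ← Real.rpow_mul hr.le, mul_one_div_cancel hd1,
        Real.rpow_one, mul_one_div]
      have : r ^ (d / (1 + d)) ≠ 0 := by positivity
      field_simp
    rw [h4, ENNReal.one_le_ofReal] at h3
    norm_num at h3

/-- For a directed family of seminorms the balls of the single seminorms form a neighbourhood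
basis of zero. -/
theorem WithSeminorms.exists_closedBall_subset {ι : Type*} [LinearOrder ι] [Nonempty ι]
    {p : SeminormFamily 𝕜 E ι} (hp : WithSeminorms p) (hm : Monotone p) {U : Set E}
    (hU : U ∈ 𝓝 (0 : E)) :
    ∃ k, ∃ ε : ℝ, 0 < ε ∧ (p k).closedBall 0 ε ⊆ U := by
  obtain ⟨s, r, hr, h⟩ := (hp.mem_nhds_iff 0 U).1 hU
  obtain ⟨k, hk⟩ := s.exists_le
  refine ⟨k, r / 2, half_pos hr, fun x hx => h ?_⟩
  rw [Seminorm.mem_closedBall_zero] at hx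
  rw [Seminorm.mem_ball_zero]
  have : s.sup p ≤ p k := Finset.sup_le fun i hi => hm (hk i hi)
  linarith [this x]

theorem WithSeminorms.closedBall_mem_nhds {ι : Type*}
    {p : SeminormFamily 𝕜 E ι} (hp : WithSeminorms p) (k : ι) {ε : ℝ} (hε : 0 < ε) :
    (p k).closedBall 0 ε ∈ 𝓝 (0 : E) :=
  mem_of_superset ((hp.mem_nhds_iff 0 _).2 ⟨{k}, ε, hε, by simp⟩)
    (Seminorm.ball_subset_closedBall (p k) 0 ε)

end Topology

/-! ### Kolmogorov diameters -/

theorem mem_smul_closedBall_add_iff {p : Seminorm 𝕜 E} {F : Submodule 𝕜 E} {r s : ℝ} (hr : 0 < r)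
    {x : E} : x ∈ (r : 𝕜) • p.closedBall 0 s + (F : Set E) ↔ ∃ f ∈ F, p (x - f) ≤ r * s := by
  have hr' : (r : 𝕜) ≠ 0 := by exact_mod_cast hr.ne'
  rw [Set.mem_add]
  constructor
  · rintro ⟨y, hy, f, hf, rfl⟩
    obtain ⟨z, hz, rfl⟩ := hy
    refine ⟨f, hf, ?_⟩
    rw [Seminorm.mem_closedBall_zero] at hz
    simp only [add_sub_cancel_right, map_smul_eq_mul, RCLike.norm_ofReal, abs_of_pos hr]
    gcongr
  · rintro ⟨f, hf, h⟩
    refine ⟨x - f, ⟨(r : 𝕜)⁻¹ • (x - f), ?_, ?_⟩, f, hf, sub_add_cancel x f⟩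
    · rw [Seminorm.mem_closedBall_zero, map_smul_eq_mul, norm_inv, RCLike.norm_ofReal,
        abs_of_pos hr, inv_mul_le_iff₀ hr]
      exact h
    · exact smul_inv_smul₀ hr' _

theorem kolmogorovDiameter_le {V U : Set E} {n : ℕ} {r : ℝ} (hr : 0 < r) (F : Submodule 𝕜 E)
    (hF : Module.rank 𝕜 F ≤ n) (h : V ⊆ (r : 𝕜) • U + (F : Set E)) :
    kolmogorovDiameter 𝕜 V U n ≤ ENNReal.ofReal r :=
  iInf_le_of_le r <| iInf_le_of_le hr <| iInf_le_of_le ⟨F, hF, h⟩ le_rfl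

theorem exists_subset_of_kolmogorovDiameter_lt {V U : Set E} {n : ℕ} {c : ℝ≥0∞}
    (h : kolmogorovDiameter 𝕜 V U n < c) :
    ∃ r : ℝ, 0 < r ∧ ENNReal.ofReal r < c ∧
      ∃ F : Submodule 𝕜 E, Module.rank 𝕜 F ≤ n ∧ V ⊆ (r : 𝕜) • U + (F : Set E) := by
  simp only [kolmogorovDiameter, iInf_lt_iff] at h
  obtain ⟨r, hr, hF, h⟩ := h
  exact ⟨r, hr, h, hF⟩

/-- If the unit ball of `p₁` lies in `D r ^ d U₂ + r⁻¹ U₀` for all `r > 0`, then a bound of order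
`e^{-s (1 + d)}` on a diameter of `U₂` with respect to `U₀` gives a bound of order `e^{-s}` on that
of `U₁`. -/
theorem kolmogorovDiameter_le_of_decomposition {p₀ p₁ p₂ : Seminorm 𝕜 E} {d D : ℝ} (hD : 0 < D)
    (h : ∀ r : ℝ, 0 < r → ∀ x, p₁ x ≤ 1 → ∃ y, p₂ y ≤ D * r ^ d ∧ p₀ (x - y) ≤ r⁻¹)
    {V : Set E} {ε : ℝ} (hε : 0 < ε) (hV : p₂.closedBall 0 ε ⊆ V) {n : ℕ} {s : ℝ}
    (hs : kolmogorovDiameter 𝕜 V (p₀.closedBall 0 1) n <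
      ENNReal.ofReal (Real.exp (-(s * (1 + d))))) :
    kolmogorovDiameter 𝕜 (p₁.closedBall 0 1) (p₀.closedBall 0 1) n ≤
      ENNReal.ofReal ((D / ε + 1) * Real.exp (-s)) := by
  obtain ⟨δ, hδ, hδs, F, hF, hVF⟩ := exists_subset_of_kolmogorovDiameter_lt hs
  rw [ENNReal.ofReal_lt_ofReal_iff (Real.exp_pos _)] at hδs
  refine kolmogorovDiameter_le (by positivity) F hF fun x hx => ?_
  rw [Seminorm.mem_closedBall_zero] at hx
  rw [mem_smul_closedBall_add_iff (by positivity)]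
  obtain ⟨y, hy, hxy⟩ := h (Real.exp s) (Real.exp_pos s) x hx
  -- rescaling `y` into the ball of radius `ε`
  set c : ℝ := D * Real.exp s ^ d / ε with hc
  have hc0 : 0 < c := by positivity
  have hyV : ((c⁻¹ : ℝ) : 𝕜) • y ∈ V := hV <| by
    rw [Seminorm.mem_closedBall_zero, map_smul_eq_mul, RCLike.norm_ofReal,
      abs_of_pos (inv_pos.2 hc0), inv_mul_le_iff₀ hc0, hc, div_mul_cancel₀ _ hε.ne']
    exact hy
  obtain ⟨f, hf, hyf⟩ := (mem_smul_closedBall_add_iff hδ).1 (hVF hyV)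
  have hc' : (c : 𝕜) ≠ 0 := by exact_mod_cast hc0.ne'
  refine ⟨(c : 𝕜) • f, F.smul_mem _ hf, ?_⟩
  have h1 : p₀ (y - (c : 𝕜) • f) ≤ c * δ := by
    have h2 : y - (c : 𝕜) • f = (c : 𝕜) • (((c⁻¹ : ℝ) : 𝕜) • y - f) := by
      rw [smul_sub, RCLike.ofReal_inv, smul_inv_smul₀ hc']
    rw [h2, map_smul_eq_mul, RCLike.norm_ofReal, abs_of_pos hc0]
    gcongr
    simpa using hyf
  have h3 : c * δ ≤ D / ε * Real.exp (-s) := by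
    calc c * δ ≤ c * Real.exp (-(s * (1 + d))) := by gcongr
      _ = D / ε * (Real.exp (s * d) * Real.exp (-(s * (1 + d)))) := by
        rw [hc, Real.exp_mul]; ring
      _ = D / ε * Real.exp (-s) := by
        rw [← Real.exp_add]; congr 2; ring
  calc p₀ (x - (c : 𝕜) • f) = p₀ ((x - y) + (y - (c : 𝕜) • f)) := by rw [sub_add_sub_cancel]
    _ ≤ p₀ (x - y) + p₀ (y - (c : 𝕜) • f) := map_add_le_add _ _ _
    _ ≤ (Real.exp s)⁻¹ + D / ε * Real.exp (-s) := add_le_add hxy (h1.trans h3)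
    _ = _ := by rw [Real.exp_neg]; ring

theorem kolmogorovDiameter_scale_le {p₀ p₁ : Seminorm 𝕜 E} {U : Set E} {ε : ℝ} (hε : 0 < ε)
    (hU : p₀.closedBall 0 ε ⊆ U) (n : ℕ) :
    kolmogorovDiameter 𝕜 (p₁.closedBall 0 1) U n ≤
      ENNReal.ofReal ε⁻¹ * kolmogorovDiameter 𝕜 (p₁.closedBall 0 1) (p₀.closedBall 0 1) n := by
  have hε' : ENNReal.ofReal ε⁻¹ ≠ 0 := (ENNReal.ofReal_pos.2 (inv_pos.2 hε)).ne'
  refine ENNReal.le_mul_of_forall_lt (.inl hε') (.inl ENNReal.ofReal_ne_top) fun a ha b hb => ?_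
  obtain ⟨r, hr, hrb, F, hF, h⟩ := exists_subset_of_kolmogorovDiameter_lt hb
  refine (kolmogorovDiameter_le (r := ε⁻¹ * r) (by positivity) F hF ?_).trans ?_
  · refine fun x hx => Set.add_subset_add_right (Set.smul_set_mono hU) ?_
    obtain ⟨f, hf, h1⟩ := (mem_smul_closedBall_add_iff hr).1 (h hx)
    refine (mem_smul_closedBall_add_iff (by positivity)).2 ⟨f, hf, h1.trans_eq ?_⟩
    field_simp
  · rw [ENNReal.ofReal_mul (inv_pos.2 hε).le]
    gcongr

end LinearTopologyLemmas

/-! ### Diameters in power series spaces of infinite type -/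

namespace PowerSeriesSpace

variable {𝕜 : Type*} [RCLike 𝕜] {α : ℕ → ℝ}

theorem toL2_apply (t : ℝ) (x : PowerSeriesSpace 𝕜 α) (i : ℕ) :
    toL2 𝕜 α t x i = (Real.exp (t * α i) : 𝕜) * x.1 i := rfl

theorem seminorm_apply (t : ℝ) (x : PowerSeriesSpace 𝕜 α) :
    PowerSeriesSpace.seminorm 𝕜 α t x = ‖toL2 𝕜 α t x‖ := rfl

theorem seminorm_le_mul {s t c : ℝ} (hc : 0 ≤ c) {x y : PowerSeriesSpace 𝕜 α}
    (h : ∀ i, Real.exp (s * α i) * ‖x.1 i‖ ≤ c * (Real.exp (t * α i) * ‖y.1 i‖)) :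
    PowerSeriesSpace.seminorm 𝕜 α s x ≤ c * PowerSeriesSpace.seminorm 𝕜 α t y := by
  have h1 : ‖toL2 𝕜 α s x‖ ≤ ‖(c : 𝕜) • toL2 𝕜 α t y‖ := by
    refine lp.norm_mono (by norm_num) fun i => ?_
    rw [lp.coeFn_smul, Pi.smul_apply, norm_smul, toL2_apply, toL2_apply, norm_mul, norm_mul]
    simpa [abs_of_nonneg hc] using h i
  rwa [norm_smul, RCLike.norm_ofReal, abs_of_nonneg hc] at h1

theorem monotone_seminorm (hα : IsExponentSequence α) :
    Monotone (PowerSeriesSpace.seminorm 𝕜 α) := by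
  intro s t hst x
  have := seminorm_le_mul (s := s) (t := t) zero_le_one (x := x) (y := x) fun i => by
    rw [one_mul]
    have := hα.nonneg i
    gcongr
  rwa [one_mul] at this

variable (𝕜 α) in
/-- The inclusion of the vectors supported on the first `n` coordinates. -/
def ofFin (n : ℕ) : (Fin n → 𝕜) →ₗ[𝕜] PowerSeriesSpace 𝕜 α where
  toFun c := ⟨fun i => if h : i < n then c ⟨i, h⟩ else 0, fun t => by
    refine Memℓp.of_exponent_ge (memℓp_zero ((Set.finite_Iio n).subset fun i hi => ?_)) zero_le
    by_contra h
    exact hi (by simp [show ¬ i < n from h])⟩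
  map_add' c c' := Subtype.ext <| funext fun i => by
    change dite _ _ _ = (dite _ _ _ : 𝕜) + dite _ _ _
    by_cases h : i < n <;> simp [h]
  map_smul' a c := Subtype.ext <| funext fun i => by
    change dite _ _ _ = a * (dite _ _ _ : 𝕜)
    by_cases h : i < n <;> simp [h]

theorem ofFin_apply_of_lt {n i : ℕ} (c : Fin n → 𝕜) (h : i < n) :
    (ofFin 𝕜 α n c).1 i = c ⟨i, h⟩ := dif_pos h

theorem ofFin_apply_of_ge {n i : ℕ} (c : Fin n → 𝕜) (h : n ≤ i) :
    (ofFin 𝕜 α n c).1 i = 0 := dif_neg h.not_gt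

theorem kolmogorovDiameter_closedBall_le (hα : IsExponentSequence α) (t : ℝ) {s : ℝ} (hs : 0 ≤ s)
    (n : ℕ) : kolmogorovDiameter 𝕜 ((PowerSeriesSpace.seminorm 𝕜 α (t + s)).closedBall 0 1)
      ((PowerSeriesSpace.seminorm 𝕜 α t).closedBall 0 1) n ≤
        ENNReal.ofReal (Real.exp (-(s * α n))) := by
  refine kolmogorovDiameter_le (Real.exp_pos _) (LinearMap.range (ofFin 𝕜 α n)) ?_ fun x hx => ?_
  · simpa using rank_range_le (ofFin 𝕜 α n)
  rw [Seminorm.mem_closedBall_zero] at hx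
  refine (mem_smul_closedBall_add_iff (Real.exp_pos _)).2 ⟨ofFin 𝕜 α n fun i => x.1 i, ⟨_, rfl⟩, ?_⟩
  refine (seminorm_le_mul (Real.exp_pos (-(s * α n))).le (t := t + s) (y := x) fun i => ?_).trans
    (by gcongr)
  change _ * ‖x.1 i - (ofFin 𝕜 α n fun i => x.1 i).1 i‖ ≤ _
  rcases lt_or_ge i n with h | h
  · rw [ofFin_apply_of_lt _ h, sub_self, norm_zero, mul_zero]
    positivity
  · rw [ofFin_apply_of_ge _ h, sub_zero, ← mul_assoc, ← Real.exp_add]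
    gcongr
    have := mul_le_mul_of_nonneg_left (hα.mono h) hs
    linarith

/-- The lower estimate of the diameters: an `n`-dimensional subspace has a nonzero orthogonal
vector among those supported on the first `n + 1` coordinates. -/
theorem le_kolmogorovDiameter (hα : IsExponentSequence α) {t ε : ℝ} (ht : 0 ≤ t) (hε : 0 < ε)
    {V : Set (PowerSeriesSpace 𝕜 α)}
    (hV : (PowerSeriesSpace.seminorm 𝕜 α t).closedBall 0 ε ⊆ V) (n : ℕ) :
    ENNReal.ofReal (ε * Real.exp (-(t * α n))) ≤
      kolmogorovDiameter 𝕜 V ((PowerSeriesSpace.seminorm 𝕜 α 0).closedBall 0 1) n := by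
  refine le_iInf fun r => le_iInf fun hr => le_iInf fun ⟨F, hF, hVF⟩ => ?_
  apply ENNReal.ofReal_le_ofReal
  have hFfin : FiniteDimensional 𝕜 F :=
    Module.rank_lt_aleph0_iff.1 (hF.trans_lt (Cardinal.natCast_lt_aleph0))
  have hFn : Module.finrank 𝕜 F ≤ n := Module.finrank_le_of_rank_le hF
  set F' := F.map (toL2 𝕜 α 0) with hF'
  have hF'n : Module.finrank 𝕜 F' < n + 1 :=
    Nat.lt_succ_of_le ((Submodule.finrank_map_le _ _).trans hFn)
  let g : (Fin (n + 1) → 𝕜) →ₗ[𝕜] F' :=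
    (F'.orthogonalProjectionOnto : _ →ₗ[𝕜] F') ∘ₗ toL2 𝕜 α 0 ∘ₗ ofFin 𝕜 α (n + 1)
  obtain ⟨c, hc, hc0⟩ := (Submodule.ne_bot_iff _).1
    (g.ker_ne_bot_of_finrank_lt (by simpa using hF'n))
  set x := ofFin 𝕜 α (n + 1) c with hx
  have hxF : toL2 𝕜 α 0 x ∈ F'ᗮ := Submodule.orthogonalProjectionOnto_eq_zero_iff.1 hc
  have hx0 : 0 < PowerSeriesSpace.seminorm 𝕜 α 0 x := by
    refine lt_of_le_of_ne (apply_nonneg _ _) fun h => hc0 (funext fun i => ?_)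
    have h1 : toL2 𝕜 α 0 x = 0 := norm_eq_zero.1 h.symm
    have h2 : toL2 𝕜 α 0 x i = 0 := by rw [h1]; rfl
    rw [toL2_apply, hx, ofFin_apply_of_lt _ i.2] at h2
    simpa using h2
  have hxt : PowerSeriesSpace.seminorm 𝕜 α t x ≤
      Real.exp (t * α n) * PowerSeriesSpace.seminorm 𝕜 α 0 x := by
    refine seminorm_le_mul (Real.exp_pos _).le fun i => ?_
    rcases lt_or_ge i (n + 1) with h | h
    · have := mul_le_mul_of_nonneg_left (hα.mono (Nat.lt_succ_iff.1 h)) ht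
      rw [zero_mul, Real.exp_zero, one_mul]
      gcongr
    · rw [hx, ofFin_apply_of_ge _ h]
      simp
  set a : ℝ := ε * Real.exp (-(t * α n)) / PowerSeriesSpace.seminorm 𝕜 α 0 x with ha
  have ha0 : 0 < a := by positivity
  have hy : (a : 𝕜) • x ∈ V := hV <| by
    rw [Seminorm.mem_closedBall_zero, map_smul_eq_mul, RCLike.norm_ofReal, abs_of_pos ha0]
    calc a * _ ≤ a * (Real.exp (t * α n) * PowerSeriesSpace.seminorm 𝕜 α 0 x) := by gcongr
      _ = ε := by
        rw [ha, Real.exp_neg]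
        field_simp
  obtain ⟨f, hf, hfr⟩ := (mem_smul_closedBall_add_iff hr).1 (hVF hy)
  have horth : inner 𝕜 ((a : 𝕜) • toL2 𝕜 α 0 x) (toL2 𝕜 α 0 f) = 0 := by
    rw [inner_smul_left, (Submodule.mem_orthogonal' _ _).1 hxF _ (Submodule.mem_map_of_mem hf),
      mul_zero]
  calc ε * Real.exp (-(t * α n)) = a * PowerSeriesSpace.seminorm 𝕜 α 0 x := by
        rw [ha, div_mul_cancel₀ _ hx0.ne']
    _ = ‖(a : 𝕜) • toL2 𝕜 α 0 x‖ := by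
        rw [norm_smul, RCLike.norm_ofReal, abs_of_pos ha0, seminorm_apply]
    _ ≤ ‖(a : 𝕜) • toL2 𝕜 α 0 x - toL2 𝕜 α 0 f‖ := by
        refine le_of_sq_le_sq ?_ (norm_nonneg _)
        have := norm_sub_sq (𝕜 := 𝕜) ((a : 𝕜) • toL2 𝕜 α 0 x) (toL2 𝕜 α 0 f)
        rw [horth] at this
        simp only [map_zero, mul_zero, sub_zero] at this
        rw [this]
        exact le_add_of_nonneg_right (sq_nonneg _)
    _ = PowerSeriesSpace.seminorm 𝕜 α 0 ((a : 𝕜) • x - f) := by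
        rw [seminorm_apply, map_sub, map_smul]
    _ ≤ r := by simpa using hfr

end PowerSeriesSpace

section DiametralDimension

variable {𝕜 : Type*} [RCLike 𝕜] {α : ℕ → ℝ}

theorem tendsto_ofReal_mul_exp_neg (hα : IsExponentSequence α) (c : ℝ) :
    Tendsto (fun n => ENNReal.ofReal (c * Real.exp (-α n))) atTop (𝓝 0) := by
  rw [← ENNReal.ofReal_zero, ← mul_zero c]
  exact (ENNReal.continuous_ofReal.tendsto _).comp
    ((Real.tendsto_exp_neg_atTop_nhds_zero.comp hα.tendsto).const_mul c)

theorem enorm_exp (x : ℝ) : ‖((Real.exp x : ℝ) : 𝕜)‖ₑ = ENNReal.ofReal (Real.exp x) := by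
  rw [← ofReal_norm, RCLike.norm_ofReal, abs_of_pos (Real.exp_pos _)]

theorem exp_mem_diametralDimension_powerSeriesSpace (hα : IsExponentSequence α) {s : ℝ}
    (hs : 0 ≤ s) :
    (fun n => (Real.exp (s * α n) : 𝕜)) ∈ diametralDimension 𝕜 (PowerSeriesSpace 𝕜 α) := by
  intro U hU
  obtain ⟨t, ε, hε, hU⟩ := (PowerSeriesSpace.withSeminorms 𝕜 α).exists_closedBall_subset
    (PowerSeriesSpace.monotone_seminorm hα) hU
  refine ⟨_, (PowerSeriesSpace.withSeminorms 𝕜 α).closedBall_mem_nhds (t + (s + 1)) one_pos, ?_⟩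
  refine tendsto_of_tendsto_of_tendsto_of_le_of_le tendsto_const_nhds
    (tendsto_ofReal_mul_exp_neg hα ε⁻¹) (fun _ => zero_le) fun n => ?_
  dsimp only
  rw [enorm_exp]
  calc _ ≤ ENNReal.ofReal (Real.exp (s * α n)) * (ENNReal.ofReal ε⁻¹ *
        ENNReal.ofReal (Real.exp (-((s + 1) * α n)))) := by
        gcongr
        refine (kolmogorovDiameter_scale_le hε hU n).trans ?_
        gcongr
        exact PowerSeriesSpace.kolmogorovDiameter_closedBall_le hα t (by positivity) n
    _ = _ := by
        rw [← ENNReal.ofReal_mul (by positivity), ← ENNReal.ofReal_mul (by positivity),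
          mul_left_comm, ← Real.exp_add]
        ring_nf

variable {X : Type*} [AddCommGroup X] [Module 𝕜 X] [TopologicalSpace X]

/-- If `Δ(X)` contains the sequences `e^{s α n}` for all `s`, then under `Ω̃` a neighbourhood `V` of
zero can be chosen for `U` independently of `s`. -/
theorem OmegaTildeFor.exists_forall_kolmogorovDiameter_le {p : ℕ → Seminorm 𝕜 X} (hm : Monotone p)
    (hp : WithSeminorms p) (hΩ : OmegaTildeFor p) (hα : IsExponentSequence α)
    (h : ∀ s : ℝ, 0 ≤ s → (fun n => (Real.exp (s * α n) : 𝕜)) ∈ diametralDimension 𝕜 X) (m : ℕ) :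
    ∃ q, ∀ s : ℕ, ∀ᶠ n in atTop,
      kolmogorovDiameter 𝕜 ((p q).closedBall 0 1) ((p m).closedBall 0 1) n ≤
        ENNReal.ofReal (Real.exp (-(s * α n))) := by
  have := hp.toPolynormableSpace
  obtain ⟨q, d, hd, hq⟩ := hΩ m
  refine ⟨q, fun s => ?_⟩
  obtain ⟨V, hV, hlim⟩ := h ((s + 1) * (1 + d)) (by positivity) _
    (hp.closedBall_mem_nhds m one_pos)
  obtain ⟨k, ε, hε, hkV⟩ := hp.exists_closedBall_subset hm hV
  obtain ⟨C, hC, hk⟩ := hq k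
  obtain ⟨D, hD, hdec⟩ := exists_decomposition_of_dualSeminorm_le (hp.continuous_seminorm m) hd hC hk
  filter_upwards [hlim.eventually_lt_const one_pos,
    hα.tendsto.eventually_ge_atTop (Real.log (D / ε + 1))] with n hn hn'
  rw [enorm_exp] at hn
  refine (kolmogorovDiameter_le_of_decomposition (s := (s + 1) * α n) hD hdec hε hkV ?_).trans ?_
  · rw [Real.exp_neg, ENNReal.ofReal_inv_of_pos (Real.exp_pos _), ENNReal.lt_inv_iff_lt_inv,
      ← ENNReal.lt_inv_iff_lt_inv, ← one_div, ENNReal.lt_div_iff_mul_lt, mul_comm]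
    · convert hn using 4
      ring
    · simp [Real.exp_pos]
    · simp
  · apply ENNReal.ofReal_le_ofReal
    calc (D / ε + 1) * Real.exp (-((s + 1) * α n))
        ≤ Real.exp (α n) * Real.exp (-((s + 1) * α n)) := by
          gcongr
          exact (Real.log_le_iff_le_exp (by positivity)).1 hn'
      _ = Real.exp (-(s * α n)) := by
          rw [← Real.exp_add]
          ring_nf

/-- Eventual validity of each of countably many conditions gives the validity of the `T n`-th
condition at `n`, for some `T` that tends to infinity. -/
theorem exists_tendsto_atTop_of_forall_eventually {P : ℕ → ℕ → Prop}
    (h : ∀ t, ∀ᶠ n in atTop, P t n) :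
    ∃ T : ℕ → ℕ, Tendsto T atTop atTop ∧ ∀ᶠ n in atTop, P (T n) n := by
  obtain ⟨φ, hφ, hP⟩ := extraction_forall_of_eventually fun t => eventually_forall_ge_atTop.2 (h t)
  refine ⟨fun n => Nat.findGreatest (fun t => φ t ≤ n) n, tendsto_atTop.2 fun t => ?_, ?_⟩
  · filter_upwards [eventually_ge_atTop (φ t)] with n hn
    exact Nat.le_findGreatest ((hφ.id_le t).trans hn) hn
  · filter_upwards [eventually_ge_atTop (φ 0)] with n hn
    exact hP _ n (Nat.findGreatest_spec (P := fun t => φ t ≤ n) (Nat.zero_le n) hn)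

/-- A space whose diametral dimension is that of a power series space of infinite type does not
have the property `Ω̃`: otherwise `Δ(X)` contains a sequence that grows faster than each
`e^{t α n}`. -/
theorem not_hasOmegaTilde_of_diametralDimension_eq (hα : IsExponentSequence α)
    (h : diametralDimension 𝕜 X = diametralDimension 𝕜 (PowerSeriesSpace 𝕜 α)) :
    ¬ HasOmegaTilde 𝕜 X := by
  rintro ⟨p, hm, hp, hΩ⟩
  choose q hq using hΩ.exists_forall_kolmogorovDiameter_le hm hp hα
    fun s hs => h ▸ exp_mem_diametralDimension_powerSeriesSpace hα hs
  obtain ⟨T, hT, hTq⟩ := exists_tendsto_atTop_of_forall_eventually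
    fun t => (eventually_all_finite (Set.finite_Iic t)).2 fun m _ => hq m t
  have hξ : (fun n => (Real.exp ((T n - 1) * α n) : 𝕜)) ∈ diametralDimension 𝕜 X := by
    intro U hU
    obtain ⟨m, ε, hε, hU⟩ := hp.exists_closedBall_subset hm hU
    refine ⟨_, hp.closedBall_mem_nhds (q m) one_pos, ?_⟩
    refine tendsto_of_tendsto_of_tendsto_of_le_of_le' tendsto_const_nhds
      (tendsto_ofReal_mul_exp_neg hα ε⁻¹) (.of_forall fun _ => zero_le) ?_
    filter_upwards [hTq, hT.eventually_ge_atTop m] with n hn hmn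
    rw [enorm_exp]
    calc _ ≤ ENNReal.ofReal (Real.exp ((T n - 1) * α n)) * (ENNReal.ofReal ε⁻¹ *
          ENNReal.ofReal (Real.exp (-(T n * α n)))) := by
          gcongr
          refine (kolmogorovDiameter_scale_le hε hU n).trans ?_
          gcongr
          exact hn m hmn
      _ = _ := by
          rw [← ENNReal.ofReal_mul (by positivity), ← ENNReal.ofReal_mul (by positivity),
            mul_left_comm, ← Real.exp_add]
          ring_nf
  rw [h] at hξ
  have hw := PowerSeriesSpace.withSeminorms 𝕜 α
  obtain ⟨V, hV, hlim⟩ := hξ _ (hw.closedBall_mem_nhds 0 one_pos)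
  obtain ⟨t, ε, hε, hV⟩ := hw.exists_closedBall_subset (PowerSeriesSpace.monotone_seminorm hα) hV
  have hV' : (PowerSeriesSpace.seminorm 𝕜 α (max t 0)).closedBall 0 ε ⊆ V := fun x hx => hV <| by
    rw [Seminorm.mem_closedBall_zero] at hx ⊢
    exact (PowerSeriesSpace.monotone_seminorm hα (le_max_left t 0) x).trans hx
  have hT' : Tendsto (fun n => (T n : ℝ)) atTop atTop := tendsto_natCast_atTop_atTop.comp hT
  obtain ⟨n, hn, hTn⟩ := ((hlim.eventually_lt_const (ENNReal.ofReal_pos.2 hε)).and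
    (hT'.eventually_ge_atTop (max t 0 + 1))).exists
  refine hn.not_ge ?_
  rw [enorm_exp]
  calc ENNReal.ofReal ε ≤ ENNReal.ofReal (Real.exp ((T n - 1) * α n)) *
        ENNReal.ofReal (ε * Real.exp (-(max t 0 * α n))) := by
        rw [← ENNReal.ofReal_mul (by positivity), mul_left_comm, ← Real.exp_add]
        apply ENNReal.ofReal_le_ofReal
        refine le_mul_of_one_le_right hε.le (Real.one_le_exp ?_)
        have := mul_nonneg (sub_nonneg.2 hTn) (hα.nonneg n)
        linarith
    _ ≤ _ := by
        gcongr
        exact PowerSeriesSpace.le_kolmogorovDiameter hα (le_max_right t 0) hε hV' n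

end DiametralDimension

/-! ### Jensen's inequality for `-log |f|` -/

/-- The value of `-(log ‖z‖) / j`, or `0` where `‖z‖ > 1`. At `z = 0` it is `∞`. -/
def negLogNorm (j : ℕ) (z : ℂ) : ℝ≥0∞ := (-ENNReal.log ‖z‖ₑ).toENNReal / j

theorem measurable_negLogNorm (j : ℕ) : Measurable (negLogNorm j) := by
  have h : Measurable fun z : ℂ => (-ENNReal.log ‖z‖ₑ).toENNReal :=
    measurable_ereal_toENNReal.comp (ENNReal.measurable_log.comp measurable_enorm).neg
  exact h.div_const _

theorem toENNReal_neg_log_ofReal {s : ℝ} (hs : 0 < s) :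
    (-ENNReal.log (ENNReal.ofReal s)).toENNReal = ENNReal.ofReal (-Real.log s) := by
  rw [ENNReal.log_ofReal_of_pos hs, ← EReal.coe_neg, EReal.real_coe_toENNReal]

theorem toENNReal_neg_log_ofReal_pow {s : ℝ} (hs : 0 < s) (j : ℕ) :
    (-ENNReal.log (ENNReal.ofReal (s ^ j))).toENNReal = ENNReal.ofReal (-Real.log s) * j := by
  rw [toENNReal_neg_log_ofReal (by positivity), Real.log_pow, ← mul_neg,
    ENNReal.ofReal_mul (by positivity), ENNReal.ofReal_natCast, mul_comm]

theorem le_negLogNorm {s : ℝ} (hs : 0 < s) {j : ℕ} (hj : 0 < j) {z : ℂ} (hz : ‖z‖ ≤ s ^ j) :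
    ENNReal.ofReal (-Real.log s) ≤ negLogNorm j z := by
  rw [negLogNorm, ENNReal.le_div_iff_mul_le (by simp [hj.ne']) (by simp),
    ← toENNReal_neg_log_ofReal_pow hs, ← ofReal_norm]
  exact EReal.toENNReal_le_toENNReal
    (EReal.neg_le_neg_iff.2 (ENNReal.log_monotone (ENNReal.ofReal_le_ofReal hz)))

theorem negLogNorm_le {s : ℝ} (hs : 0 < s) {j : ℕ} (hj : 0 < j) {z : ℂ} (hz : s ^ j ≤ ‖z‖) :
    negLogNorm j z ≤ ENNReal.ofReal (-Real.log s) := by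
  rw [negLogNorm, ENNReal.div_le_iff (by simp [hj.ne']) (by simp),
    ← toENNReal_neg_log_ofReal_pow hs, ← ofReal_norm]
  exact EReal.toENNReal_le_toENNReal
    (EReal.neg_le_neg_iff.2 (ENNReal.log_monotone (ENNReal.ofReal_le_ofReal hz)))

theorem log_norm_le_circleAverage {f : ℂ → ℂ} (hf : AnalyticOnNhd ℂ f (Metric.closedBall 0 1))
    (h0 : f 0 ≠ 0) : Real.log ‖f 0‖ ≤ Real.circleAverage (fun z => Real.log ‖f z‖) 0 1 := by
  have hf' : AnalyticOnNhd ℂ f (Metric.closedBall 0 |1|) := by rwa [abs_one]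
  rw [hf'.circleAverage_log_norm one_ne_zero h0]
  refine le_add_of_nonneg_left (finsum_nonneg fun u => ?_)
  by_cases hu : u ∈ Metric.closedBall (0 : ℂ) |1|
  · refine mul_nonneg (mod_cast MeromorphicOn.AnalyticOnNhd.divisor_nonneg hf' _) ?_
    rw [one_mul, zero_sub, norm_neg, Real.log_inv, neg_nonneg]
    exact Real.log_nonpos (norm_nonneg u) (by simpa using hu)
  · rw [Function.locallyFinsuppWithin.apply_eq_zero_of_notMem _ hu, Int.cast_zero, zero_mul]

/-- The normalized Lebesgue measure on `(0, 2π]`. -/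
def angleMeasure : Measure ℝ :=
  (ENNReal.ofReal (2 * Real.pi))⁻¹ • volume.restrict (Ioc 0 (2 * Real.pi))

theorem lintegral_angleMeasure (f : ℝ → ℝ≥0∞) : ∫⁻ θ, f θ ∂angleMeasure =
    (∫⁻ θ in Ioc 0 (2 * Real.pi), f θ) / ENNReal.ofReal (2 * Real.pi) := by
  rw [angleMeasure, lintegral_smul_measure, smul_eq_mul, ENNReal.div_eq_inv_mul]

/-- The sub-mean value property of `log |f|`. The zeros of `f` on the circle, where the real
logarithm has a junk value, form a null set. -/
theorem lintegral_negLogNorm_le {f : ℂ → ℂ} (hf : AnalyticOnNhd ℂ f (Metric.closedBall 0 1))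
    (hb : ∀ c : ℂ, ‖c‖ ≤ 1 → ‖f c‖ ≤ 1) {j : ℕ} (hj : 0 < j) :
    ∫⁻ θ : ℝ, negLogNorm j (f (Complex.exp (θ * Complex.I))) ∂angleMeasure ≤
      negLogNorm j (f 0) := by
  have hj' : (j : ℝ≥0∞)⁻¹ ≠ ⊤ := by simp [hj.ne']
  simp only [negLogNorm, ENNReal.div_eq_inv_mul]
  rw [lintegral_const_mul' _ _ hj']
  gcongr
  by_cases h0 : f 0 = 0
  · simp [h0]
  have hnz : ∀ z : ℂ, z ≠ 0 → (-ENNReal.log ‖z‖ₑ).toENNReal = ENNReal.ofReal (-Real.log ‖z‖) :=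
    fun z hz => by rw [← ofReal_norm, toENNReal_neg_log_ofReal (norm_pos_iff.2 hz)]
  have hmap : ∀ θ : ℝ, Complex.exp (θ * Complex.I) = circleMap 0 1 θ := by simp [circleMap]
  have hae : ∀ᵐ θ : ℝ ∂volume.restrict (Ioc 0 (2 * Real.pi)), f (circleMap 0 1 θ) ≠ 0 := by
    have h1 : f ⁻¹' {0}ᶜ ∈ codiscreteWithin (Metric.sphere (0 : ℂ) |1|) :=
      codiscreteWithin_mono (by rw [abs_one]; exact Metric.sphere_subset_closedBall)
        (hf.preimage_zero_mem_codiscreteWithin h0 (by simp)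
          ⟨⟨0, by simp⟩, (convex_closedBall (0 : ℂ) 1).isPreconnected⟩)
    exact ae_restrict_le_codiscreteWithin measurableSet_Ioc
      (codiscreteWithin_mono (by tauto) (circleMap_preimage_codiscrete one_ne_zero h1))
  have hsph : ∀ θ : ℝ, ‖circleMap 0 1 θ‖ ≤ 1 := by simp
  have hint : CircleIntegrable (fun z => Real.log ‖f z‖) 0 1 :=
    MeromorphicOn.circleIntegrable_log_norm
      (hf.mono (by rw [abs_one]; exact Metric.sphere_subset_closedBall)).meromorphicOn
  have hint' : Integrable (fun θ => -Real.log ‖f (circleMap 0 1 θ)‖)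
      (volume.restrict (Ioc 0 (2 * Real.pi))) :=
    ((intervalIntegrable_iff_integrableOn_Ioc_of_le Real.two_pi_pos.le).1 hint).neg
  rw [hnz _ h0, lintegral_angleMeasure]
  calc (∫⁻ θ in Ioc 0 (2 * Real.pi), (-ENNReal.log ‖f (Complex.exp (θ * Complex.I))‖ₑ).toENNReal) /
        ENNReal.ofReal (2 * Real.pi)
      = (∫⁻ θ in Ioc 0 (2 * Real.pi), ENNReal.ofReal (-Real.log ‖f (circleMap 0 1 θ)‖)) /
        ENNReal.ofReal (2 * Real.pi) := by
        congr 1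
        refine lintegral_congr_ae (hae.mono fun θ hθ => ?_)
        dsimp only
        rw [hmap, hnz _ hθ]
    _ = ENNReal.ofReal (-Real.circleAverage (fun z => Real.log ‖f z‖) 0 1) := by
        rw [← ofReal_integral_eq_lintegral_ofReal hint' (.of_forall fun θ => neg_nonneg.2
          (Real.log_nonpos (norm_nonneg _) (hb _ (hsph θ)))),
          ← ENNReal.ofReal_div_of_pos Real.two_pi_pos, Real.circleAverage,
          intervalIntegral.integral_of_le Real.two_pi_pos.le, integral_neg, smul_eq_mul, neg_div,
          div_eq_inv_mul]
    _ ≤ _ := ENNReal.ofReal_le_ofReal (neg_le_neg (log_norm_le_circleAverage hf h0))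

/-! ### Relaxed limits and plurisubharmonicity -/

/-- The lower half-relaxed limit of a sequence of functions: the lower limit of `N k y` for
`k → ∞` and `y → x`. -/
def relaxedLiminf {M : Type*} [TopologicalSpace M] (N : ℕ → M → ℝ≥0∞) (x : M) : ℝ≥0∞ :=
  liminf (fun y : ℕ × M => N y.1 y.2) (atTop ×ˢ 𝓝 x)

theorem lowerSemicontinuous_relaxedLiminf {M : Type*} [TopologicalSpace M]
    (N : ℕ → M → ℝ≥0∞) : LowerSemicontinuous (relaxedLiminf N) := by
  intro x c hc
  obtain ⟨c', hcc', hc'⟩ := exists_between hc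
  obtain ⟨P, hP, Q, hQ, h⟩ := eventually_prod_iff.1 (eventually_lt_of_lt_liminf hc')
  filter_upwards [eventually_eventually_nhds.2 hQ] with y hy
  refine hcc'.trans_le (le_liminf_of_le (by isBoundedDefault) ?_)
  exact (hP.prod_mk hy).mono fun z hz => (h hz.1 hz.2).le

theorem relaxedLiminf_le_liminf {M ι : Type*} [TopologicalSpace M] {N : ℕ → M → ℝ≥0∞} {x : M}
    {l : Filter ι} {k : ι → ℕ} {y : ι → M} (hk : Tendsto k l atTop) (hy : Tendsto y l (𝓝 x)) :
    relaxedLiminf N x ≤ liminf (fun i => N (k i) (y i)) l :=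
  (hk.prodMk hy).liminf_le_liminf_comp (u := fun z : ℕ × M => N z.1 z.2)

variable {n : ℕ} {M : Type*} [TopologicalSpace M] [ChartedSpace (EuclideanSpace ℂ (Fin n)) M]

theorem analyticOnNhd_comp_disc [IsManifold 𝓘(ℂ, EuclideanSpace ℂ (Fin n)) ω M] {G : M → ℂ}
    (hG : MDifferentiable 𝓘(ℂ, EuclideanSpace ℂ (Fin n)) 𝓘(ℂ, ℂ) G)
    {e : OpenPartialHomeomorph M (EuclideanSpace ℂ (Fin n))}
    (he : e ∈ atlas (EuclideanSpace ℂ (Fin n)) M) {a b : EuclideanSpace ℂ (Fin n)}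
    (hab : ∀ c : ℂ, ‖c‖ ≤ 1 → a + c • b ∈ e.target) :
    AnalyticOnNhd ℂ (fun c : ℂ => G (e.symm (a + c • b))) (Metric.closedBall 0 1) := by
  have : IsManifold 𝓘(ℂ, EuclideanSpace ℂ (Fin n)) 1 M := .of_le le_top
  have h1 : DifferentiableOn ℂ (G ∘ e.symm) e.target :=
    mdifferentiableOn_iff_differentiableOn.1
      (hG.comp_mdifferentiableOn (mdifferentiableOn_atlas_symm he))
  have hd : Differentiable ℂ fun c : ℂ => a + c • b := by fun_prop
  have h2 : DifferentiableOn ℂ (fun c : ℂ => G (e.symm (a + c • b)))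
      ((fun c : ℂ => a + c • b) ⁻¹' e.target) :=
    h1.comp hd.differentiableOn fun _ hc => hc
  exact (h2.analyticOnNhd (e.open_target.preimage hd.continuous)).mono
    fun c hc => hab c (by simpa using hc)

/-- The upper half-relaxed limit of the functions `log |G k| / j k` is plurisubharmonic, if each
compact set lies in `{|G k| ≤ 1}` for all large `k`. Since the relaxed limit also runs over nearby
centres, Fatou's lemma yields the sub-mean value property directly, with no regularization. -/
theorem isPlurisubharmonic_neg_relaxedLiminf [IsManifold 𝓘(ℂ, EuclideanSpace ℂ (Fin n)) ω M]
    {G : ℕ → M → ℂ}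
    (hG : ∀ k, MDifferentiable 𝓘(ℂ, EuclideanSpace ℂ (Fin n)) 𝓘(ℂ, ℂ) (G k))
    {j : ℕ → ℕ} (hj : ∀ k, 0 < j k)
    (hb : ∀ K : Set M, IsCompact K → ∀ᶠ k in atTop, ∀ x ∈ K, ‖G k x‖ ≤ 1) :
    IsPlurisubharmonic n fun x : M =>
      -(relaxedLiminf (fun k y => negLogNorm (j k) (G k y)) x : EReal) := by
  set N : ℕ → M → ℝ≥0∞ := fun k y => negLogNorm (j k) (G k y) with hN
  intro e he
  refine ⟨fun v hv c hc => ?_, fun v _ => ?_, fun a b hab => ?_⟩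
  · have h1 : LowerSemicontinuous fun x => (relaxedLiminf N x : EReal) :=
      continuous_coe_ennreal_ereal.comp_lowerSemicontinuous (lowerSemicontinuous_relaxedLiminf N)
        EReal.coe_ennreal_strictMono.monotone
    have h2 := (e.symm.continuousAt hv).eventually (h1 (e.symm v) (-c) (EReal.neg_lt_comm.1 hc))
    exact mem_nhdsWithin_of_mem_nhds (h2.mono fun v' hv' => EReal.neg_lt_comm.1 hv')
  · exact lt_of_le_of_lt (EReal.neg_le_zero.2 (EReal.coe_ennreal_nonneg _)) EReal.zero_lt_top
  · have ha : a ∈ e.target := by simpa using hab 0 (by simp)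
    have key : ∫⁻ θ : ℝ, relaxedLiminf N (e.symm (a + Complex.exp (θ * Complex.I) • b))
        ∂angleMeasure ≤ relaxedLiminf N (e.symm a) := by
      have hdisc : IsCompact ((fun c : ℂ => a + c • b) '' Metric.closedBall 0 1) :=
        (isCompact_closedBall _ _).image (by fun_prop)
      obtain ⟨δ, hδ, hδs⟩ := hdisc.exists_cthickening_subset_open e.open_target
        (by rintro _ ⟨c, hc, rfl⟩; exact hab c (by simpa using hc))
      have hcpt := hdisc.cthickening (r := δ)
      have hmem : ∀ y ∈ Metric.closedBall a δ, ∀ c : ℂ, ‖c‖ ≤ 1 → y + c • b ∈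
          Metric.cthickening δ ((fun c : ℂ => a + c • b) '' Metric.closedBall 0 1) :=
        fun y hy c hc => Metric.mem_cthickening_of_dist_le _ (a + c • b) _ _
          ⟨c, by simpa using hc, rfl⟩ (by simpa using hy)
      -- the indices for which the disc about `y` lies in the chart
      set S : Set (ℕ × EuclideanSpace ℂ (Fin n)) := {i | i.2 ∈ Metric.closedBall a δ} with hS
      have hSev : ∀ᶠ i in atTop ×ˢ 𝓝 a, i ∈ S :=
        tendsto_snd.eventually (Metric.closedBall_mem_nhds a hδ)
      have hsmall : ∀ᶠ i in atTop ×ˢ 𝓝 a, ∀ c : ℂ, ‖c‖ ≤ 1 →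
          ‖G i.1 (e.symm (i.2 + c • b))‖ ≤ 1 := by
        have h1 := hb _ (hcpt.image_of_continuousOn (e.continuousOn_symm.mono hδs))
        filter_upwards [tendsto_fst.eventually h1, hSev] with i hi hiS c hc
        exact hi _ (mem_image_of_mem _ (hmem _ hiS c hc))
      calc ∫⁻ θ : ℝ, relaxedLiminf N (e.symm (a + Complex.exp (θ * Complex.I) • b)) ∂angleMeasure
          ≤ ∫⁻ θ : ℝ, liminf (fun i : ℕ × EuclideanSpace ℂ (Fin n) => S.indicator
              (fun i => N i.1 (e.symm (i.2 + Complex.exp (θ * Complex.I) • b))) i)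
              (atTop ×ˢ 𝓝 a) ∂angleMeasure := by
            refine lintegral_mono fun θ => ?_
            rw [liminf_congr (hSev.mono fun i hi => indicator_of_mem hi _)]
            refine relaxedLiminf_le_liminf tendsto_fst ?_
            have h1 := hab (Complex.exp (θ * Complex.I)) (Complex.norm_exp_ofReal_mul_I θ).le
            exact (e.symm.continuousAt h1).tendsto.comp (tendsto_snd.add_const _)
        _ ≤ liminf (fun i : ℕ × EuclideanSpace ℂ (Fin n) => ∫⁻ θ : ℝ, S.indicator
              (fun i => N i.1 (e.symm (i.2 + Complex.exp (θ * Complex.I) • b))) i ∂angleMeasure)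
              (atTop ×ˢ 𝓝 a) := by
            refine lintegral_liminf_le fun i => ?_
            by_cases hi : i ∈ S
            · simp only [indicator_of_mem hi]
              have h1 : Continuous fun θ : ℝ => Complex.exp (θ * Complex.I) := by fun_prop
              have h2 := (analyticOnNhd_comp_disc (hG i.1) he
                fun c hc => hδs (hmem _ hi c hc)).continuousOn
              exact (measurable_negLogNorm _).comp (h2.comp_continuous h1
                fun θ => by simp [Complex.norm_exp_ofReal_mul_I]).measurable
            · simp only [indicator_of_notMem hi]
              exact measurable_const
        _ ≤ liminf (fun i : ℕ × EuclideanSpace ℂ (Fin n) => N i.1 (e.symm i.2))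
              (atTop ×ˢ 𝓝 a) := by
            refine liminf_le_liminf ?_
            filter_upwards [hSev, hsmall] with i hi hi'
            simp only [indicator_of_mem hi]
            have h1 := lintegral_negLogNorm_le (analyticOnNhd_comp_disc (hG i.1) he
                fun c hc => hδs (hmem _ hi c hc)) hi' (hj i.1)
            simpa using h1
        _ ≤ relaxedLiminf N (e.symm a) := by
            have hx : e.symm a ∈ e.source := e.map_target ha
            have h1 : Tendsto e (𝓝 (e.symm a)) (𝓝 a) := by
              have := (e.continuousAt hx).tendsto
              rwa [e.right_inv ha] at this
            have h2 : Tendsto (fun z : ℕ × M => (z.1, e z.2)) (atTop ×ˢ 𝓝 (e.symm a))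
                (atTop ×ˢ 𝓝 a) := tendsto_id.prodMap h1
            refine (h2.liminf_le_liminf_comp
              (u := fun i : ℕ × EuclideanSpace ℂ (Fin n) => N i.1 (e.symm i.2))).trans_eq ?_
            refine liminf_congr ?_
            filter_upwards [tendsto_snd.eventually (e.open_source.mem_nhds hx)] with z hz
            simp [e.left_inv hz]
    have h0 : ∀ x : M, (-(relaxedLiminf N x : EReal)).toENNReal = 0 := fun x =>
      EReal.toENNReal_of_nonpos (EReal.neg_le_zero.2 (EReal.coe_ennreal_nonneg _))
    simp only [circleMean, Function.comp_apply, h0, neg_neg, EReal.toENNReal_coe, lintegral_zero,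
      ENNReal.zero_div, EReal.coe_ennreal_zero, zero_sub]
    rw [← lintegral_angleMeasure, EReal.neg_le_neg_iff]
    exact EReal.coe_ennreal_le_coe_ennreal_iff.2 key

/-! ### Holomorphic functions on parabolic Stein manifolds -/

namespace HolomorphicFunctions

variable {n : ℕ} {M : Type*} [TopologicalSpace M] [ChartedSpace (EuclideanSpace ℂ (Fin n)) M]

theorem hasBasis_nhds_zero :
    (𝓝 (0 : HolomorphicFunctions n M)).HasBasis (fun i : Set M × ℝ => IsCompact i.1 ∧ 0 < i.2)
      fun i => {f | ∀ x ∈ i.1, ‖f.1 x‖ ≤ i.2} := by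
  have h1 := nhds_basis_uniformity'
    (Filter.HasBasis.compactConvergenceUniformity (α := M) (β := ℂ) Metric.uniformity_basis_dist_le)
    (x := (0 : C(M, ℂ)))
  rw [nhds_subtype_eq_comap]
  refine (h1.comap _).to_hasBasis (fun i hi => ⟨i, hi, fun f hf => ?_⟩)
    (fun i hi => ⟨i, hi, fun f hf => ?_⟩)
  · intro x hx
    simpa using hf x hx
  · intro x hx
    simpa using hf x hx

/-- The power `(c f) ^ j` as a holomorphic function. -/
def smulPow (c : ℂ) (f : HolomorphicFunctions n M) (j : ℕ) : HolomorphicFunctions n M :=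
  ⟨(c • f.1) ^ j, by
    have := MDifferentiable.pow (c • f).2 j
    rwa [← ContinuousMap.coe_pow] at this⟩

theorem smulPow_apply (c : ℂ) (f : HolomorphicFunctions n M) (j : ℕ) (x : M) :
    (smulPow c f j).1 x = (c * f.1 x) ^ j := rfl

/-- The approximants behind the failure of `Ω̃`: the powers `(ρ f) ^ φ k` are approximated on the
compact set `K` up to `(ρ / 4) ^ φ k` by functions `g k` that are bounded by `A ^ φ k` on the `k`-th
set of the exhaustion, where `A` does not depend on `k`. It is here that the exponent `d` in `Ω̃`
must not depend on the third seminorm. -/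
theorem exists_approximants {p : ℕ → Seminorm ℂ (HolomorphicFunctions n M)} (hm : Monotone p)
    (hp : WithSeminorms p) (hΩ : OmegaTildeFor p) (L : ℕ → Set M) (hL : ∀ k, IsCompact (L k))
    {K : Set M} (hK : IsCompact K) (f : HolomorphicFunctions n M) :
    ∃ ρ A : ℝ, 0 < ρ ∧ ρ ≤ 1 ∧ 1 ≤ A ∧ ∃ (φ : ℕ → ℕ) (g : ℕ → HolomorphicFunctions n M),
      ∀ k, 0 < φ k ∧ (∀ x ∈ L k, ‖(g k).1 x‖ ≤ A ^ φ k) ∧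
        ∀ x ∈ K, ‖(ρ * f.1 x) ^ φ k - (g k).1 x‖ ≤ (ρ / 4) ^ φ k := by
  have := hp.toPolynormableSpace
  have hsup : ∀ K : Set M, IsCompact K → ∃ m, ∃ ε : ℝ, 0 < ε ∧
      ∀ (g : HolomorphicFunctions n M), ∀ x ∈ K, ‖g.1 x‖ ≤ ε⁻¹ * p m g := by
    intro K hK
    obtain ⟨m, ε, hε, h⟩ := hp.exists_closedBall_subset hm
      (hasBasis_nhds_zero.mem_of_mem (i := (K, 1)) ⟨hK, one_pos⟩)
    refine ⟨m, ε, hε, fun g x hx => ?_⟩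
    refine le_of_forall_pos_le_add fun η hη => ?_
    -- `p m g` may vanish, hence the small summand in the scaling factor
    set t : ℝ := ε⁻¹ * p m g + η with ht
    have ht0 : 0 < t := by positivity
    have h1 : ((t⁻¹ : ℝ) : ℂ) • g ∈ (p m).closedBall 0 ε := by
      rw [Seminorm.mem_closedBall_zero, map_smul_eq_mul, Complex.norm_real, Real.norm_eq_abs,
        abs_of_pos (inv_pos.2 ht0), inv_mul_le_iff₀ ht0, ht, add_mul, mul_right_comm,
        inv_mul_cancel₀ hε.ne', one_mul]
      have : 0 ≤ η * ε := by positivity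
      linarith
    have h2 : ‖((t⁻¹ : ℝ) : ℂ) * g.1 x‖ ≤ 1 := h h1 x hx
    rwa [norm_mul, Complex.norm_real, Real.norm_eq_abs, abs_of_pos (inv_pos.2 ht0),
      inv_mul_le_iff₀ ht0, mul_one] at h2
  obtain ⟨m, ε, hε, hmK⟩ := hsup K hK
  obtain ⟨q, d, hd, hq⟩ := hΩ m
  obtain ⟨⟨K', δ⟩, ⟨hK', hδ⟩, hqK⟩ := hasBasis_nhds_zero.mem_iff.1
    (hp.closedBall_mem_nhds q one_pos)
  obtain ⟨B, hB⟩ := hK'.exists_bound_of_continuousOn f.1.continuous.continuousOn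
  set ρ : ℝ := min δ 1 / (|B| + 1) with hρ
  have hδ1 : 0 < min δ 1 := lt_min hδ one_pos
  have hρ0 : 0 < ρ := by positivity
  have hρ1 : ρ ≤ 1 := div_le_one_of_le₀ ((min_le_right _ _).trans (by simp)) (by positivity)
  have hball : ∀ j : ℕ, 0 < j → p q (smulPow ρ f j) ≤ 1 := by
    intro j hj
    rw [← Seminorm.mem_closedBall_zero]
    refine hqK fun x hx => ?_
    have h1 : ‖(ρ : ℂ) * f.1 x‖ ≤ min δ 1 := by
      rw [norm_mul, Complex.norm_real, Real.norm_eq_abs, abs_of_pos hρ0, hρ, div_mul_eq_mul_div]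
      refine div_le_of_le_mul₀ (by positivity) hδ1.le ?_
      gcongr
      linarith [hB x hx, le_abs_self B]
    rw [smulPow_apply, norm_pow]
    exact (pow_le_of_le_one (norm_nonneg _) (h1.trans (min_le_right _ _)) hj.ne').trans
      (h1.trans (min_le_left _ _))
  have hdec : ∀ k, ∃ D : ℝ, 0 < D ∧ ∀ r : ℝ, 0 < r → ∀ h, p q h ≤ 1 →
      ∃ g : HolomorphicFunctions n M, (∀ x ∈ L k, ‖g.1 x‖ ≤ D * r ^ d) ∧
        ∀ x ∈ K, ‖h.1 x - g.1 x‖ ≤ ε⁻¹ * r⁻¹ := by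
    intro k
    obtain ⟨l, η, hη, hlk⟩ := hsup (L k) (hL k)
    obtain ⟨C, hC, hl⟩ := hq l
    obtain ⟨D, hD, h⟩ := exists_decomposition_of_dualSeminorm_le (hp.continuous_seminorm m) hd hC hl
    refine ⟨η⁻¹ * D, by positivity, fun r hr h' hh' => ?_⟩
    obtain ⟨g, hg, hg'⟩ := h r hr h' hh'
    refine ⟨g, fun x hx => (hlk g x hx).trans ?_, fun x hx => (hmK (h' - g) x hx).trans ?_⟩
    · rw [mul_assoc]
      gcongr
    · gcongr
  choose D hD hdec using hdec
  -- along a subsequence the constants `D k` are absorbed into an exponential factor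
  obtain ⟨φ, -, hφ⟩ := extraction_forall_of_eventually
    (P := fun k j : ℕ => 0 < j ∧ D k * ε⁻¹ ^ d ≤ Real.exp j) fun k =>
    (eventually_gt_atTop 0).and
      ((Real.tendsto_exp_atTop.comp tendsto_natCast_atTop_atTop).eventually_ge_atTop _)
  have hg : ∀ k, ∃ g : HolomorphicFunctions n M,
      (∀ x ∈ L k, ‖g.1 x‖ ≤ (Real.exp 1 * (4 / ρ) ^ d) ^ φ k) ∧
        ∀ x ∈ K, ‖(ρ * f.1 x) ^ φ k - g.1 x‖ ≤ (ρ / 4) ^ φ k := by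
    intro k
    obtain ⟨g, hg, hg'⟩ := hdec k (ε⁻¹ * (4 / ρ) ^ φ k) (by positivity) _
      (hball (φ k) (hφ k).1)
    refine ⟨g, fun x hx => (hg x hx).trans ?_, fun x hx => (hg' x hx).trans_eq ?_⟩
    · rw [Real.mul_rpow (by positivity) (by positivity), ← mul_assoc, mul_pow, ← Real.exp_nat_mul,
        mul_one, ← Real.rpow_natCast, ← Real.rpow_natCast, ← Real.rpow_mul (by positivity),
        ← Real.rpow_mul (by positivity), mul_comm d]
      gcongr
      exact (hφ k).2
    · rw [mul_inv, inv_inv, ← mul_assoc, inv_mul_cancel₀ hε.ne', one_mul, ← inv_pow, inv_div]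
  choose g hgL hgK using hg
  refine ⟨ρ, Real.exp 1 * (4 / ρ) ^ d, hρ0, hρ1, ?_, φ, g, fun k => ⟨(hφ k).1, hgL k, hgK k⟩⟩
  refine one_le_mul_of_one_le_of_one_le (Real.one_le_exp zero_le_one)
    (Real.one_le_rpow ?_ hd.le)
  rw [one_le_div hρ0]
  linarith

/-- A Stein manifold of positive dimension carries a holomorphic function with the values `0` and
`1`. -/
theorem exists_apply_eq_zero_and_one [Nonempty M] (hn : 0 < n) (hS : IsStein n M) :
    ∃ (f : HolomorphicFunctions n M) (w z : M), f.1 w = 0 ∧ f.1 z = 1 := by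
  obtain ⟨x⟩ := ‹Nonempty M›
  have : Nonempty (Fin n) := ⟨⟨0, hn⟩⟩
  set e := chartAt (EuclideanSpace ℂ (Fin n)) x with he
  have hx : e x ∈ e.target := e.map_source (mem_chart_source _ x)
  have h1 : ∀ᶠ v in 𝓝[≠] (e x), v ∈ e.target ∧ v ≠ e x :=
    (eventually_nhdsWithin_of_eventually_nhds (e.open_target.mem_nhds hx)).and
      self_mem_nhdsWithin
  have : (𝓝[≠] (e x)).NeBot := Module.punctured_nhds_neBot ℂ _ _
  obtain ⟨v, hv, hvx⟩ := h1.exists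
  have hne : e.symm v ≠ x := fun h => hvx (by rw [← h, e.right_inv hv])
  obtain ⟨f, hf, hfne⟩ := hS.separates _ _ hne
  have hconst : ContinuousMap.const M (f x) ∈ HolomorphicFunctions n M :=
    mdifferentiable_const
  refine ⟨(f (e.symm v) - f x)⁻¹ • (⟨f, hf⟩ - ⟨_, hconst⟩), x, e.symm v, ?_, ?_⟩
  · change (f (e.symm v) - f x)⁻¹ * (f x - f x) = 0
    simp
  · exact inv_mul_cancel₀ (sub_ne_zero.2 hfne)

/-- On a connected parabolic Stein manifold `Ω̃` fails: with the approximants `g k`, the relaxed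
upper limit of `log |g k| / φ k` would be a bounded plurisubharmonic function that is at most
`log (ρ / 2)` near a zero of `f` and at least `log (3 ρ / 4)` where `f = 1`. -/
theorem not_hasOmegaTilde [SecondCountableTopology M] [Nonempty M]
    [IsManifold 𝓘(ℂ, EuclideanSpace ℂ (Fin n)) ω M]
    (hn : 0 < n) (hS : IsStein n M) (hP : IsParabolic n M) :
    ¬ HasOmegaTilde ℂ (HolomorphicFunctions n M) := by
  rintro ⟨p, hm, hp, hΩ⟩
  have : LocallyCompactSpace M := ChartedSpace.locallyCompactSpace (EuclideanSpace ℂ (Fin n)) M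
  obtain ⟨f, w, z, hw, hz⟩ := exists_apply_eq_zero_and_one hn hS
  let L : CompactExhaustion M := CompactExhaustion.choice M
  have hnear : ∀ᶠ x in 𝓝 w, ‖f.1 x‖ < 1 / 4 :=
    f.1.continuous.norm.continuousAt.eventually_lt_const (by simp [hw])
  obtain ⟨K, hKw, hKf, hK⟩ := local_compact_nhds hnear
  obtain ⟨ρ, A, hρ, hρ1, hA, φ, g, hg⟩ := exists_approximants hm hp hΩ L L.isCompact
    (hK.insert z) f
  have hA0 : 0 < A := by linarith
  set G : ℕ → HolomorphicFunctions n M := fun k => ((A ^ φ k : ℝ) : ℂ)⁻¹ • g k with hG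
  have hGnorm : ∀ k x, ‖(G k).1 x‖ = ‖(g k).1 x‖ / A ^ φ k := fun k x => by
    change ‖((A ^ φ k : ℝ) : ℂ)⁻¹ * (g k).1 x‖ = _
    rw [norm_mul, norm_inv, Complex.norm_real, Real.norm_eq_abs, abs_of_pos (by positivity),
      inv_mul_eq_div]
  have hb : ∀ K : Set M, IsCompact K → ∀ᶠ k in atTop, ∀ x ∈ K, ‖(G k).1 x‖ ≤ 1 := by
    intro K hK
    obtain ⟨k₀, hk₀⟩ := L.exists_superset_of_isCompact hK
    filter_upwards [eventually_ge_atTop k₀] with k hk x hx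
    rw [hGnorm]
    exact div_le_one_of_le₀ ((hg k).2.1 x (L.subset hk (hk₀ hx))) (by positivity)
  set N : ℕ → M → ℝ≥0∞ := fun k y => negLogNorm (φ k) ((G k).1 y) with hN
  have hpsh := isPlurisubharmonic_neg_relaxedLiminf (fun k => (G k).2) (fun k => (hg k).1) hb
  obtain ⟨c, hc⟩ := hP _ hpsh ⟨0, fun x => by
    rw [EReal.coe_zero]
    exact EReal.neg_le_zero.2 (EReal.coe_ennreal_nonneg _)⟩
  have hwz : relaxedLiminf N w = relaxedLiminf N z := by
    have h1 := (hc w).trans (hc z).symm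
    rwa [neg_inj, EReal.coe_ennreal_eq_coe_ennreal_iff] at h1
  have hNw : ENNReal.ofReal (-Real.log (ρ / 2 / A)) ≤ relaxedLiminf N w := by
    refine le_liminf_of_le (by isBoundedDefault) ?_
    filter_upwards [tendsto_snd.eventually hKw] with i hi
    obtain ⟨hφ, -, hgK⟩ := hg i.1
    refine le_negLogNorm (by positivity) hφ ?_
    rw [hGnorm, div_pow]
    gcongr
    have h1 : ‖(ρ * f.1 i.2) ^ φ i.1‖ ≤ (ρ / 4) ^ φ i.1 := by
      rw [norm_pow, norm_mul, Complex.norm_real, Real.norm_eq_abs, abs_of_pos hρ]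
      have : ‖f.1 i.2‖ < 1 / 4 := hKf hi
      gcongr
      nlinarith
    calc ‖(g i.1).1 i.2‖ ≤ ‖(ρ * f.1 i.2) ^ φ i.1‖ + ‖(ρ * f.1 i.2) ^ φ i.1 - (g i.1).1 i.2‖ := by
          rw [norm_sub_rev]; exact norm_le_norm_add_norm_sub' _ _
      _ ≤ (ρ / 4) ^ φ i.1 + (ρ / 4) ^ φ i.1 :=
          add_le_add h1 (hgK _ (mem_insert_of_mem _ hi))
      _ = 2 * (ρ / 4) ^ φ i.1 := (two_mul _).symm
      _ ≤ 2 ^ φ i.1 * (ρ / 4) ^ φ i.1 := by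
          gcongr
          exact le_self_pow₀ one_le_two hφ.ne'
      _ = (ρ / 2) ^ φ i.1 := by
          rw [← mul_pow]
          ring_nf
  have hNz : relaxedLiminf N z ≤ ENNReal.ofReal (-Real.log (3 * ρ / 4 / A)) := by
    refine (relaxedLiminf_le_liminf (l := atTop) (k := id) tendsto_id
      (tendsto_const_nhds (x := z))).trans ?_
    refine (liminf_le_liminf (v := fun _ => ENNReal.ofReal (-Real.log (3 * ρ / 4 / A)))
      (.of_forall fun k => ?_)).trans_eq (liminf_const _)
    obtain ⟨hφ, -, hgK⟩ := hg k
    refine negLogNorm_le (by positivity) hφ ?_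
    change _ ≤ ‖(G k).1 z‖
    rw [hGnorm, div_pow]
    gcongr
    have h1 := hgK z (mem_insert _ _)
    rw [hz, mul_one] at h1
    have h2 : ‖(ρ : ℂ) ^ φ k‖ = ρ ^ φ k := by
      rw [norm_pow, Complex.norm_real, Real.norm_eq_abs, abs_of_pos hρ]
    have h3 : ‖(ρ : ℂ) ^ φ k‖ ≤ ‖(g k).1 z‖ + ‖(ρ : ℂ) ^ φ k - (g k).1 z‖ :=
      norm_le_norm_add_norm_sub' _ _
    have h4 : (3 * ρ / 4) ^ φ k + (ρ / 4) ^ φ k ≤ (3 * ρ / 4 + ρ / 4) ^ φ k :=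
      pow_add_pow_le (by positivity) (by positivity) hφ.ne'
    have h5 : 3 * ρ / 4 + ρ / 4 = ρ := by ring
    rw [h5] at h4
    linarith
  have h1 := hNw.trans (hwz.le.trans hNz)
  have h2 : ρ / 2 / A < 1 := by
    rw [div_lt_one hA0]
    linarith
  have h3 : 0 < -Real.log (ρ / 2 / A) := neg_pos.2 (Real.log_neg (by positivity) h2)
  have h4 : Real.log (ρ / 2 / A) < Real.log (3 * ρ / 4 / A) :=
    Real.log_lt_log (by positivity) (div_lt_div_of_pos_right (by linarith) hA0)
  exact h1.not_gt ((ENNReal.ofReal_lt_ofReal_iff h3).2 (neg_lt_neg h4))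

end HolomorphicFunctions

end

theorem mainTheorem3 :
    (∀ (𝕜 : Type*) [RCLike 𝕜] (X : Type*) [AddCommGroup X] [Module 𝕜 X] [UniformSpace X]
        [IsUniformAddGroup X] [ContinuousSMul 𝕜 X] [PolynormableSpace 𝕜 X]
        [FirstCountableTopology X] [T2Space X] [CompleteSpace X] (α : ℕ → ℝ),
      IsNuclearSpace 𝕜 X →
      IsExponentSequence α → IsWeaklyStable α → IsNuclearSpace 𝕜 (PowerSeriesSpace 𝕜 α) →
      diametralDimension 𝕜 X = diametralDimension 𝕜 (PowerSeriesSpace 𝕜 α) →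
      ¬ HasOmegaTilde 𝕜 X) ∧
    (∀ (n : ℕ) (M : Type*) [TopologicalSpace M] [T2Space M] [SecondCountableTopology M]
        [ConnectedSpace M] [ChartedSpace (EuclideanSpace ℂ (Fin n)) M]
        [IsManifold 𝓘(ℂ, EuclideanSpace ℂ (Fin n)) ω M],
      0 < n → IsStein n M → IsParabolic n M →
      ¬ HasOmegaTilde ℂ (HolomorphicFunctions n M)) :=
  ⟨fun _ _ _ _ _ _ _ _ _ _ _ _ _ _ hα _ _ h => not_hasOmegaTilde_of_diametralDimension_eq hα h,
    fun _ _ _ _ _ _ _ _ hn hS hP => HolomorphicFunctions.not_hasOmegaTilde hn hS hP⟩
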